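/- Let $r\ge 3$. An $r$-graph is a finite $r$-uniform hypergraph. Say that an $r$-graph contains a copy of $F$ if there is an injection of the vertices of $F$ into its vertices that maps every edge of $F$ to an edge, and that it is $F$-free otherwise. For $r$-graphs $F,G$ let $f_{F,G}(n)$ be the maximum $m$ such that every $n$-vertex $G$-free $r$-graph has an $F$-free induced subgraph on $m$ vertices (with the value $0$ if no such $m$ exists, which happens under the assumptions below only if $F$ has no vertices). For an $r$-graph $H$ with edge set $E(H)$ let $\binom{X}{k}$ be the set of $k$-element subsets of $X$ and $\partial_k H=\bigcup_{e\in E(H)}\binom{e}{k}$. We say that $G$ is $k$-shadow-homomorphic to $F$ if one can choose for each $S\in\partial_k G$ a set $f(S)\in\partial_k F$ and a bijection $g_S:S\to f(S)$ such that for every edge $e\in E(G)$ there are an edge $e'\in E(F)$ and a bijection $g:e\to e'$ with $g|_S=g_S$ for all $S\in\binom{e}{k}$. **Theorem 1.7.** For every $r$-graph $F$ there is a constant $c>0$, depending only on $F$, such that the following holds for every integer $k$ with $2\le k<r$ and every $r$-graph $G$: if $G$ is not $k$-shadow-homomorphic to $F$, then for all sufficiently large $n$ $$f_{F,G}(n)\le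 c\,(\log n)^{1/(k-1)}.$$ -/

import Mathlib

/-- An `r`-uniform hypergraph (`r`-graph) whose vertex set is the whole type `V`. -/
@[ext]
structure UniformHypergraph (r : ℕ) (V : Type*) where
  /-- The set of edges. -/
  edges : Set (Finset V)
  /-- Every edge has exactly `r` vertices. -/
  card_eq : ∀ e ∈ edges, e.card = r

namespace UniformHypergraph

/-- The `k`-shadow of `H`: the `k`-graph on the same vertices whose edges are the `k`-subsets of
edges of `H`. -/
def shadow {r : ℕ} {V : Type*} (k : ℕ) (H : UniformHypergraph r V) : UniformHypergraph k V where
  edges := {S | S.card = k ∧ ∃ e ∈ H.edges, S ⊆ e}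
  card_eq := fun _ hS => hS.1

/-- `H` contains a copy of `F` (as a not necessarily induced subgraph): there is an injection of the
vertices of `F` into those of `H` that maps edges to edges. -/
def Contains {r : ℕ} {V W : Type*} (H : UniformHypergraph r W) (F : UniformHypergraph r V) : Prop :=
  ∃ φ : V ↪ W, ∀ e ∈ F.edges, e.map φ ∈ H.edges

/-- `H` is `F`-free: it contains no copy of `F`. -/
def FreeOf {r : ℕ} {V W : Type*} (H : UniformHypergraph r W) (F : UniformHypergraph r V) : Prop :=
  ¬ H.Contains F

/-- The subgraph of `H` induced on the vertex set `U`: its edges are the edges of `H` inside `U`. -/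
def induce {r : ℕ} {W : Type*} (H : UniformHypergraph r W) (U : Finset W) :
    UniformHypergraph r U where
  edges := {e | e.map (Function.Embedding.subtype (· ∈ U)) ∈ H.edges}
  card_eq := fun _ he => by simpa using H.card_eq _ he

/-- `G` is `k`-shadow-homomorphic to `F`: to each `S ∈ ∂ₖG` one can assign some `f S ∈ ∂ₖF` and a
bijection `g S : S → f S` such that every edge `e` of `G` has a bijection `h` onto some edge `e'`
of `F` with `h` restricting to `g S` on each `k`-subset `S` of `e`. -/
def ShadowHom {r : ℕ} {V W : Type*} (k : ℕ) (G : UniformHypergraph r W)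
    (F : UniformHypergraph r V) : Prop :=
  ∃ (f : (G.shadow k).edges → (F.shadow k).edges)
    (g : ∀ S : (G.shadow k).edges, (S : Finset W) ≃ (f S : Finset V)),
    ∀ e ∈ G.edges, ∃ e' ∈ F.edges, ∃ h : e ≃ e',
      ∀ (S : (G.shadow k).edges) (hS : (S : Finset W) ⊆ e) (x : (S : Finset W)),
        (h ⟨x, hS x.2⟩ : V) = (g S x : V)

/-- The set of all `m` such that every `n`-vertex `G`-free `r`-graph has an `F`-free induced
subgraph on `m` vertices. -/
def erdosRogersSet {r : ℕ} {V W : Type*} (F : UniformHypergraph r V) (G : UniformHypergraph r W)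
    (n : ℕ) : Set ℕ :=
  {m | ∀ H : UniformHypergraph r (Fin n), H.FreeOf G →
    ∃ U : Finset (Fin n), U.card = m ∧ (H.induce U).FreeOf F}

/-- The Erdős–Rogers function `f_{F,G}(n)`: the maximum `m` such that every `n`-vertex `G`-free
`r`-graph has an `F`-free induced subgraph on `m` vertices. -/
noncomputable def erdosRogers {r : ℕ} {V W : Type*} (F : UniformHypergraph r V)
    (G : UniformHypergraph r W) (n : ℕ) : ℕ :=
  sSup (erdosRogersSet F G n)

/-- The supremum in `erdosRogers` is a genuine maximum as soon as `F` has a vertex and `G` has an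
edge. -/
theorem erdosRogers_isGreatest {r : ℕ} {V W : Type*} [Nonempty V] (F : UniformHypergraph r V)
    (G : UniformHypergraph r W) (hG : G.edges.Nonempty) (n : ℕ) :
    IsGreatest (erdosRogersSet F G n) (erdosRogers F G n) := by
  have hne : (erdosRogersSet F G n).Nonempty := by
    refine ⟨0, fun H _ => ⟨∅, rfl, ?_⟩⟩
    rintro ⟨φ, -⟩
    exact Finset.notMem_empty _ (φ (Classical.arbitrary V)).2
  have hb : BddAbove (erdosRogersSet F G n) := by
    refine ⟨n, fun m hm => ?_⟩
    obtain ⟨U, hU, -⟩ := hm ⟨∅, fun e he => absurd he (by simp)⟩ (by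
      rintro ⟨φ, hφ⟩
      obtain ⟨e, he⟩ := hG
      exact hφ e he)
    simpa [hU] using Finset.card_le_univ U
  exact ⟨Nat.sSup_mem hne hb, fun m hm => le_csSup hb hm⟩

/-- A hypergraph that is not `k`-shadow-homomorphic to some other one has an edge. -/
theorem edges_nonempty_of_not_shadowHom {r k : ℕ} {V W : Type*} {G : UniformHypergraph r W}
    {F : UniformHypergraph r V} (h : ¬ G.ShadowHom k F) : G.edges.Nonempty := by
  by_contra hG
  have hE : G.edges = ∅ := Set.not_nonempty_iff_eq_empty.mp hG
  have hS : ∀ S : (G.shadow k).edges, False := by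
    rintro ⟨S, -, e, he, -⟩
    simp [hE] at he
  exact h ⟨fun S => (hS S).elim, fun S => (hS S).elim, fun e he => by simp [hE] at he⟩

end UniformHypergraph

/-!
The graph `G` is not `k`-shadow-homomorphic to `F`, so a `G`-free graph arises by prescribing the
maps on `k`-sets: give every `k`-set `S` of the `n` vertices a map `S → V(F)`, and declare an
`r`-set an edge when these maps, over all of its `k`-subsets, are the restrictions of one bijection
onto an edge of `F`. A copy of `G` in this graph would make the prescribed maps a
`k`-shadow-homomorphism from `G` to `F` (`freeOf_ofColouring`). On the other hand, if on a set `T`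
of `v = |V(F)|` vertices all the maps are restrictions of one bijection `T → V(F)`, then `T` spans
a copy of `F` (`contains_induce_ofColouring`).

Take the maps uniformly at random. A fixed `T` then spans a copy of `F` with probability at least
`v ^ (-k * v.choose k)`, and these events are independent for sets `T` that pairwise share fewer
than `k` vertices. An `m`-set contains at least `m.choose k / (v.choose k) ^ 2` such sets
(`exists_packing`), so it fails to span a copy of `F` with probability `exp (-Ω(m ^ k))`
(`card_le_of_forall_exists_ne`). A union bound over the at most `n ^ m` sets of size `m` succeeds
once `m ^ (k - 1)` exceeds a constant times `log n` (`exists_colouring_contains_induce`).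
Probabilities are expressed by counting colourings.
-/

open Finset

/-! ### Colourings that miss every block -/

/-- Among the functions `β → V`, at most a proportion `(1 - |V| ^ (-b)) ^ |P|` disagree somewhere
with `τ j` on each of the pairwise disjoint blocks `I j`, `j ∈ P`, of size at most `b`. This is the
independence of the events "agree with `τ j` on `I j`", in counting form. -/
theorem card_le_of_forall_exists_ne {ι β V : Type*} [Fintype β] [Fintype V] [Nonempty V]
    (P : Finset ι) (I : ι → Finset β) (τ : ι → β → V) (b : ℕ) (hI : ∀ j ∈ P, #(I j) ≤ b)
    (hd : ∀ i ∈ P, ∀ j ∈ P, i ≠ j → Disjoint (I i) (I j)) (D : Finset (β → V))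
    (hD : ∀ ω ∈ D, ∀ j ∈ P, ∃ x ∈ I j, ω x ≠ τ j x) :
    (#D : ℝ) ≤ (Fintype.card V : ℝ) ^ Fintype.card β *
      (1 - ((Fintype.card V : ℝ) ^ b)⁻¹) ^ #P := by
  classical
  have hDsub : D ⊆ ({ω | ∀ j ∈ P, ∃ x ∈ I j, ω x ≠ τ j x} : Finset (β → V)) :=
    fun ω hω => mem_filter.2 ⟨mem_univ _, hD ω hω⟩
  refine (Nat.cast_le.2 (card_le_card hDsub)).trans ?_
  clear hD hDsub
  have hv : 1 ≤ Fintype.card V := Fintype.card_pos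
  have hv' : (1 : ℝ) ≤ Fintype.card V := by exact_mod_cast hv
  have hq : 0 ≤ 1 - ((Fintype.card V : ℝ) ^ b)⁻¹ :=
    sub_nonneg.2 (inv_le_one_of_one_le₀ (one_le_pow₀ hv'))
  induction P using Finset.induction_on with
  | empty => simp [card_univ]
  | insert j P hj ih =>
    have ih := ih (fun i hi => hI i (mem_insert_of_mem hi)) fun i hi i' hi' =>
      hd i (mem_insert_of_mem hi) i' (mem_insert_of_mem hi')
    set A : Finset (β → V) := {ω | ∀ i ∈ P, ∃ x ∈ I i, ω x ≠ τ i x} with hA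
    set B : Finset (β → V) := A.filter fun ω => ∀ x ∈ I j, ω x = τ j x with hB
    have hsplit : ({ω : β → V | ∀ i ∈ insert j P, ∃ x ∈ I i, ω x ≠ τ i x} : Finset (β → V)) =
        A \ B := by
      ext ω
      simp only [hA, hB, mem_filter, mem_univ, true_and, mem_sdiff, forall_mem_insert, not_and,
        not_forall]
      exact ⟨fun h => ⟨h.2, fun _ => by simpa using h.1⟩, fun h => ⟨by simpa using h.2 h.1, h.1⟩⟩
    -- Overwriting a colouring by `τ j` on the block `I j` does not affect the other blocks, and
    -- the original is recovered from its restriction to `I j`.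
    have hcard : #A ≤ Fintype.card V ^ b * #B := by
      let ov : (β → V) → β → V := fun ω x => if x ∈ I j then τ j x else ω x
      refine Finset.card_le_mul_card_image_of_maps_to (f := ov) ?_ _ ?_
      · intro ω hω
        simp only [hA, hB, mem_filter, mem_univ, true_and] at hω ⊢
        refine ⟨fun i hi => ?_, fun x hx => by simp [ov, hx]⟩
        obtain ⟨x, hx, hne⟩ := hω i hi
        have hij : i ≠ j := fun h => hj (h ▸ hi)
        have : x ∉ I j := disjoint_left.1
          (hd i (mem_insert_of_mem hi) j (mem_insert_self j P) hij) hx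
        exact ⟨x, hx, by simpa [ov, this] using hne⟩
      · intro η _
        have h1 : #{ω ∈ A | ov ω = η} ≤ #(univ : Finset (I j → V)) := by
          refine card_le_card_of_injOn (fun ω x => ω x) (fun _ _ => mem_coe.2 (mem_univ _)) ?_
          intro ω hω ω' hω' h
          have e : ov ω = ov ω' := (mem_filter.1 hω).2.trans (mem_filter.1 hω').2.symm
          funext x
          by_cases hx : x ∈ I j
          · exact congrFun h ⟨x, hx⟩
          · simpa [ov, hx] using congrFun e x
        refine h1.trans ?_
        simpa using Nat.pow_le_pow_right hv (hI j (mem_insert_self j P))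
    have hBA : B ⊆ A := filter_subset _ _
    have hpos : (0 : ℝ) < (Fintype.card V : ℝ) ^ b := by positivity
    have hcard' : ((Fintype.card V : ℝ) ^ b)⁻¹ * #A ≤ #B := by
      rw [inv_mul_le_iff₀ hpos]
      exact_mod_cast hcard
    rw [hsplit, cast_card_sdiff hBA, card_insert_of_notMem hj, pow_succ, ← mul_assoc]
    nlinarith [mul_le_mul_of_nonneg_right ih hq]

/-! ### Partial Steiner systems -/

/-- Many `v`-subsets of `U` pairwise share fewer than `k` elements: in a maximal such family every
`v`-subset of `U` has a `k`-set in common with some member. -/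
theorem exists_packing {α : Type*} [DecidableEq α] (U : Finset α) {k v : ℕ} (hkv : k ≤ v)
    (hv : v ≤ #U) :
    ∃ P : Finset (Finset α), (∀ T ∈ P, T ⊆ U ∧ #T = v) ∧
      (∀ T ∈ P, ∀ T' ∈ P, T ≠ T' → #(T ∩ T') < k) ∧ (#U).choose k ≤ #P * v.choose k ^ 2 := by
  let C : Finset (Finset (Finset α)) :=
    {P ∈ (U.powersetCard v).powerset | ∀ T ∈ P, ∀ T' ∈ P, T ≠ T' → #(T ∩ T') < k}
  have hC : C.Nonempty := ⟨∅, by simp [C]⟩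
  obtain ⟨P, hP, hmax⟩ := exists_max_image C card hC
  simp only [C, mem_filter, mem_powerset] at hP hmax
  refine ⟨P, fun T hT => mem_powersetCard.1 (hP.1 hT), hP.2, ?_⟩
  have hmeet : ∀ X ∈ U.powersetCard v, ∃ T ∈ P, k ≤ #(T ∩ X) := by
    intro X hX
    by_contra! hcon
    have hXP : X ∉ P := fun h => by
      have := hcon X h
      rw [inter_self, (mem_powersetCard.1 hX).2] at this
      omega
    have := hmax (insert X P) ⟨insert_subset hX hP.1, by
      intro T hT T' hT' hne
      rcases mem_insert.1 hT with h | h <;> rcases mem_insert.1 hT' with h' | h'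
      · exact absurd (h.trans h'.symm) hne
      · rw [h, inter_comm]
        exact hcon _ h'
      · rw [h']
        exact hcon _ h
      · exact hP.2 _ h _ h' hne⟩
    rw [card_insert_of_notMem hXP] at this
    omega
  have hcover : U.powersetCard v ⊆ P.biUnion fun T => (T.powersetCard k).biUnion fun S =>
      {X ∈ U.powersetCard v | S ⊆ X} := by
    intro X hX
    obtain ⟨T, hT, hTX⟩ := hmeet X hX
    obtain ⟨S, hS, hSk⟩ := exists_subset_card_eq hTX
    simp only [mem_biUnion, mem_filter]
    exact ⟨T, hT, S, mem_powersetCard.2 ⟨hS.trans inter_subset_left, hSk⟩, hX,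
      hS.trans inter_subset_right⟩
  have hcount : (#U).choose v ≤ #P * (v.choose k * (#U - k).choose (v - k)) := by
    rw [← card_powersetCard]
    refine (card_le_card hcover).trans (card_biUnion_le_card_mul _ _ _ fun T hT => ?_)
    obtain ⟨hTU, hTv⟩ := mem_powersetCard.1 (hP.1 hT)
    rw [← hTv, ← card_powersetCard, hTv]
    refine card_biUnion_le_card_mul _ _ _ fun S hS => ?_
    obtain ⟨hST, hSk⟩ := mem_powersetCard.1 hS
    rw [← hSk, ← card_sdiff_of_subset (hST.trans hTU), ← card_powersetCard]
    refine card_le_card_of_injOn (· \ S) ?_ ?_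
    · intro X hX
      simp only [coe_filter, mem_powersetCard, Set.mem_ofPred_eq] at hX
      exact mem_coe.2 (mem_powersetCard.2
        ⟨sdiff_subset_sdiff hX.1.1 subset_rfl, by rw [card_sdiff_of_subset hX.2, hX.1.2]⟩)
    · intro X hX Y hY h
      rw [← sdiff_union_of_subset (mem_filter.1 hX).2, ← sdiff_union_of_subset (mem_filter.1 hY).2]
      exact congrArg (· ∪ S) h
  have hpos : 0 < (#U - k).choose (v - k) := Nat.choose_pos (by omega)
  refine Nat.le_of_mul_le_mul_right ?_ hpos
  rw [← Nat.choose_mul hkv]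
  calc _ ≤ #P * (v.choose k * (#U - k).choose (v - k)) * v.choose k := Nat.mul_le_mul_right _ hcount
    _ = _ := by ring

/-! ### The lower bound on binomial coefficients -/

theorem div_pow_le_choose {m k : ℕ} (h : k ≤ m) : ((m : ℝ) / k) ^ k ≤ m.choose k := by
  induction k generalizing m with
  | zero => simp
  | succ k ih =>
    obtain ⟨m, rfl⟩ : ∃ l, m = l + 1 := ⟨m - 1, by omega⟩
    have hkm : k ≤ m := by omega
    have h1 : (((m + 1).choose (k + 1) : ℕ) : ℝ) =
        ((m + 1 : ℕ) : ℝ) / ((k + 1 : ℕ) : ℝ) * m.choose k := by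
      have := Nat.add_one_mul_choose_eq m k
      field_simp
      exact_mod_cast this.symm
    rw [h1, pow_succ']
    refine mul_le_mul_of_nonneg_left ?_ (by positivity)
    refine le_trans ?_ (ih hkm)
    rcases Nat.eq_zero_or_pos k with rfl | hk
    · simp
    refine pow_le_pow_left₀ (by positivity) ?_ _
    have hk' : (0 : ℝ) < k := by exact_mod_cast hk
    rw [div_le_div_iff₀ (by positivity) hk']
    have : (k : ℝ) ≤ m := by exact_mod_cast hkm
    push_cast
    nlinarith

/-! ### The graph of a colouring -/

namespace UniformHypergraph

/-- The `r`-graph on `α` defined by a map `S → V` for each `k`-subset `S` of `α`: its edges are the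
sets `e` with a bijection onto an edge of `F` that restricts to the given map on every `k`-subset
of `e`. The maps are encoded by one function `ω` on pairs: `x ∈ S` is sent to `ω (S, x)`, and the
values of `ω` at pairs with `x ∉ S` or `|S| ≠ k` play no role. -/
def ofColouring {r : ℕ} {α V : Type*} (k : ℕ) (F : UniformHypergraph r V)
    (ω : Finset α × α → V) : UniformHypergraph r α where
  edges := {e | ∃ e' ∈ F.edges, ∃ h : e ≃ e', ∀ S ⊆ e, #S = k →
    ∀ x : e, (x : α) ∈ S → (h x : V) = ω (S, x)}
  card_eq := by
    rintro e ⟨e', he', h, -⟩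
    rw [← F.card_eq e' he', ← Fintype.card_coe, ← Fintype.card_coe, Fintype.card_congr h]

/-- A copy of `G` in the graph of a colouring pulls the colouring back to a
`k`-shadow-homomorphism from `G` to `F`. -/
theorem freeOf_ofColouring {r k : ℕ} {α V W : Type*} {F : UniformHypergraph r V}
    {G : UniformHypergraph r W} (hG : ¬ G.ShadowHom k F) (ω : Finset α × α → V) :
    (F.ofColouring k ω).FreeOf G := by
  classical
  rintro ⟨ψ, hψ⟩
  apply hG
  -- The bijections from edges of `G` onto edges of `F`, transported along the copy `ψ`.
  have key : ∀ e ∈ G.edges, ∃ e' ∈ F.edges, ∃ h : e ≃ e', ∀ S ⊆ e, #S = k →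
      ∀ x : e, (x : W) ∈ S → (h x : V) = ω (S.map ψ, ψ x) := by
    intro e he
    obtain ⟨e', he', h, hh⟩ := hψ e he
    refine ⟨e', he', (e.equivMap ψ).trans h, fun S hS hk x hx => ?_⟩
    exact hh (S.map ψ) (map_subset_map.2 hS) (by simpa using hk) (e.equivMap ψ x)
      (mem_map_of_mem ψ hx)
  -- The map of a shadow set is given by `ω` alone, so it does not depend on the edge containing it.
  have main : ∀ S : (G.shadow k).edges, ∃ f : (F.shadow k).edges,
      ∃ g : (S : Finset W) ≃ (f : Finset V), ∀ x, (g x : V) = ω ((S : Finset W).map ψ, ψ x) := by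
    rintro ⟨S, hk, e, he, hS⟩
    obtain ⟨e', he', h, hh⟩ := key e he
    have hinj : Function.Injective fun x : S => ω (S.map ψ, ψ x) := by
      intro x y hxy
      have h1 := hh S hS hk ⟨x, hS x.2⟩ x.2
      have h2 := hh S hS hk ⟨y, hS y.2⟩ y.2
      have := h.injective (Subtype.ext (h1.trans (hxy.trans h2.symm)))
      exact Subtype.ext (congrArg (fun z : e => (z : W)) this)
    let T : Finset V := univ.map ⟨_, hinj⟩
    have hT : T ∈ (F.shadow k).edges := by
      refine ⟨by simpa [T] using hk, e', he', fun y hy => ?_⟩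
      obtain ⟨x, -, rfl⟩ := mem_map.1 hy
      change ω (S.map ψ, ψ x) ∈ e'
      rw [← hh S hS hk ⟨x, hS x.2⟩ x.2]
      exact (h _).2
    refine ⟨⟨T, hT⟩, Equiv.ofBijective
      (fun x => ⟨ω (S.map ψ, ψ x), mem_map.2 ⟨x, mem_univ _, rfl⟩⟩) ⟨?_, ?_⟩, fun x => rfl⟩
    · exact fun x y hxy => hinj (congrArg Subtype.val hxy)
    · rintro ⟨y, hy⟩
      obtain ⟨x, -, rfl⟩ := mem_map.1 hy
      exact ⟨x, rfl⟩
  choose f g hg using main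
  refine ⟨f, g, fun e he => ?_⟩
  obtain ⟨e', he', h, hh⟩ := key e he
  refine ⟨e', he', h, fun S hS x => ?_⟩
  rw [hg, hh S hS S.2.1 ⟨x, hS x.2⟩ x.2]

/-- If all the maps on `k`-subsets of `T` are restrictions of a bijection `T ≃ V`, then the inverse
bijection embeds `F`. -/
theorem contains_induce_ofColouring {r k : ℕ} {α V : Type*} {F : UniformHypergraph r V}
    {ω : Finset α × α → V} {U T : Finset α} (hTU : T ⊆ U) (σ : V ≃ T)
    (hω : ∀ S ⊆ T, #S = k → ∀ x : T, (x : α) ∈ S → ω (S, x) = σ.symm x) :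
    ((F.ofColouring k ω).induce U).Contains F := by
  classical
  let φ : V ↪ U := ⟨fun y => ⟨σ y, hTU (σ y).2⟩, fun y z h => σ.injective
    (Subtype.ext (congrArg (fun u : U => (u : α)) h))⟩
  refine ⟨φ, fun e he => ⟨e, he, ?_⟩⟩
  have hmap : (e.map φ).map (Function.Embedding.subtype (· ∈ U)) =
      e.map (φ.trans (Function.Embedding.subtype (· ∈ U))) := map_map _ _ _
  rw [hmap]
  refine ⟨(e.equivMap _).symm, fun S hS hk x hx => ?_⟩
  obtain ⟨y, rfl⟩ :=
    (e.equivMap (φ.trans (Function.Embedding.subtype (· ∈ U)))).surjective x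
  have hST : S ⊆ T := fun z hz => by
    obtain ⟨w, -, rfl⟩ := mem_map.1 (hS hz)
    exact (σ w).2
  rw [Equiv.symm_apply_apply]
  have := hω S hST hk (σ y) hx
  rw [Equiv.symm_apply_apply] at this
  exact this.symm

/-! ### The union bound -/

/-- The hypothesis `hlt` says that the union bound over all `m`-sets succeeds, the failure
probability of one `m`-set being at most
`exp (-m.choose k / ((v.choose k) ^ 2 * v ^ (k * v.choose k)))` with `v = |V|`. -/
theorem exists_colouring_contains_induce {r k m : ℕ} {α V : Type*} [Fintype α] [Fintype V]
    [Nonempty V] (F : UniformHypergraph r V) (hk : k ≤ Fintype.card V) (hm : Fintype.card V ≤ m)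
    (hlt : (m : ℝ) * Real.log (Fintype.card α) * (Fintype.card V).choose k ^ 2 *
      (Fintype.card V : ℝ) ^ (k * (Fintype.card V).choose k) < m.choose k) :
    ∃ ω : Finset α × α → V, ∀ U : Finset α, #U = m →
      ((F.ofColouring k ω).induce U).Contains F := by
  classical
  set v := Fintype.card V with hv
  set b := k * v.choose k with hb
  have hv0 : 0 < v := Fintype.card_pos
  have hq0 : (0 : ℝ) < (v : ℝ) ^ b := by positivity
  have hC0 : (0 : ℝ) < (v.choose k : ℝ) ^ 2 := by
    have := Nat.choose_pos hk
    positivity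
  -- `bad U` holds the colourings for which `U` spans no copy of `F`.
  let bad : Finset α → Finset (Finset α × α → V) := fun U =>
    {ω | ¬ ((F.ofColouring k ω).induce U).Contains F}
  have hbad : ∀ U ∈ (univ : Finset α).powersetCard m,
      (#(bad U) : ℝ) ≤ (v : ℝ) ^ Fintype.card (Finset α × α) *
        Real.exp (-(m.choose k / (v.choose k ^ 2 * (v : ℝ) ^ b))) := by
    intro U hU
    obtain ⟨-, hU⟩ := mem_powersetCard.1 hU
    obtain ⟨P, hP, hdis, hcard⟩ := exists_packing U hk (by rw [hU]; exact hm)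
    -- For each member `T` of the packing, `τ` extends a fixed bijection `T → V` to all of `α`.
    have hτ : ∀ T : Finset α, ∃ τ : α → V, T ∈ P → ∃ σ : V ≃ T, ∀ x : T, τ x = σ.symm x := by
      intro T
      by_cases hT : T ∈ P
      · let σ : V ≃ T := Fintype.equivOfCardEq (by rw [Fintype.card_coe, (hP T hT).2])
        exact ⟨fun x => if hx : x ∈ T then σ.symm ⟨x, hx⟩ else Classical.arbitrary V,
          fun _ => ⟨σ, fun x => by simp⟩⟩
      · exact ⟨fun _ => Classical.arbitrary V, fun h => absurd h hT⟩
    choose τ hτ using hτ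
    -- The coordinates of `ω` that decide whether `T` spans a copy of `F` via `τ T`.
    let I : Finset α → Finset (Finset α × α) := fun T =>
      (T.powersetCard k).biUnion fun S => {S} ×ˢ S
    have memI : ∀ {T S x}, (S, x) ∈ I T ↔ (S ⊆ T ∧ #S = k) ∧ x ∈ S := by
      intro T S x
      simp only [I, mem_biUnion, mem_powersetCard, mem_product, mem_singleton]
      exact ⟨fun ⟨S', h, h1, h2⟩ => by subst h1; exact ⟨h, h2⟩, fun ⟨h, h2⟩ => ⟨S, h, rfl, h2⟩⟩
    have hIcard : ∀ T ∈ P, #(I T) ≤ b := by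
      intro T hT
      refine (card_biUnion_le_card_mul _ _ k fun S hS => ?_).trans ?_
      · rw [card_product, card_singleton, (mem_powersetCard.1 hS).2, one_mul]
      · rw [card_powersetCard, (hP T hT).2, hb, mul_comm]
    have hIdisj : ∀ T ∈ P, ∀ T' ∈ P, T ≠ T' → Disjoint (I T) (I T') := by
      -- A common coordinate `(S, x)` would put the `k`-set `S` inside `T ∩ T'`.
      intro T hT T' hT' hne
      rw [disjoint_left]
      rintro ⟨S, x⟩ h h'
      have h := (memI.1 h).1
      have := card_le_card (subset_inter h.1 (memI.1 h').1.1)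
      have := hdis T hT T' hT' hne
      omega
    have hle := card_le_of_forall_exists_ne P I (fun T i => τ T i.2) b hIcard hIdisj (bad U) <| by
      intro ω hω T hT
      by_contra! hcon
      obtain ⟨σ, hσ⟩ := hτ T hT
      exact (mem_filter.1 hω).2 (contains_induce_ofColouring (hP T hT).1 σ fun S hS hSk x hx =>
        (hcon (S, x) (memI.2 ⟨⟨hS, hSk⟩, hx⟩)).trans (hσ x))
    refine hle.trans (mul_le_mul_of_nonneg_left ?_ (by positivity))
    have hq1 : ((v : ℝ) ^ b)⁻¹ ≤ 1 := inv_le_one_of_one_le₀ (one_le_pow₀ (by exact_mod_cast hv0))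
    calc (1 - ((v : ℝ) ^ b)⁻¹) ^ #P ≤ Real.exp (-((v : ℝ) ^ b)⁻¹) ^ #P :=
          pow_le_pow_left₀ (sub_nonneg.2 hq1) (Real.one_sub_le_exp_neg _) _
      _ = Real.exp (-(#P * ((v : ℝ) ^ b)⁻¹)) := by rw [← Real.exp_nat_mul]; ring_nf
      _ ≤ _ := by
        refine Real.exp_le_exp.2 (neg_le_neg ?_)
        rw [← div_div, div_eq_mul_inv _ ((v : ℝ) ^ b)]
        refine mul_le_mul_of_nonneg_right ?_ (by positivity)
        rw [div_le_iff₀ hC0]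
        rw [hU] at hcard
        exact_mod_cast hcard
  by_contra! hcon
  have hcover : (univ : Finset (Finset α × α → V)) ⊆
      ((univ : Finset α).powersetCard m).biUnion bad := by
    intro ω _
    obtain ⟨U, hU, h⟩ := hcon ω
    exact mem_biUnion.2 ⟨U, mem_powersetCard.2 ⟨subset_univ _, hU⟩, by simpa [bad] using h⟩
  have hα : 0 < Fintype.card α := by
    obtain ⟨U, hU, -⟩ := hcon fun _ => Classical.arbitrary V
    have := card_le_univ U
    omega
  have hα' : (0 : ℝ) < Fintype.card α := by exact_mod_cast hα
  set N : ℝ := (v : ℝ) ^ Fintype.card (Finset α × α) with hN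
  have hN0 : 0 < N := by positivity
  have hNcard : N = #(univ : Finset (Finset α × α → V)) := by
    rw [card_univ, Fintype.card_fun, Nat.cast_pow]
  set t : ℝ := m.choose k / (v.choose k ^ 2 * (v : ℝ) ^ b) with ht
  have h1 : N ≤ (Fintype.card α).choose m * (N * Real.exp (-t)) := by
    calc N ≤ ∑ U ∈ (univ : Finset α).powersetCard m, (#(bad U) : ℝ) := by
          rw [hNcard]
          exact_mod_cast (card_le_card hcover).trans card_biUnion_le
      _ ≤ _ := by
        refine (sum_le_card_nsmul _ _ _ hbad).trans_eq ?_
        rw [card_powersetCard, nsmul_eq_mul, card_univ]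
  have h2 : ((Fintype.card α).choose m : ℝ) ≤ Real.exp (m * Real.log (Fintype.card α)) := by
    rw [Real.exp_nat_mul, Real.exp_log hα']
    exact_mod_cast Nat.choose_le_pow _ _
  have h3 : (m : ℝ) * Real.log (Fintype.card α) < t := by
    rw [ht, lt_div_iff₀ (by positivity), ← mul_assoc]
    exact hlt
  have h4 : Real.exp (m * Real.log (Fintype.card α)) * Real.exp (-t) < 1 := by
    rw [← Real.exp_add, Real.exp_lt_one_iff]
    linarith
  have h5 : ((Fintype.card α).choose m : ℝ) * Real.exp (-t) < 1 :=
    (mul_le_mul_of_nonneg_right h2 (Real.exp_pos _).le).trans_lt h4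
  nlinarith

end UniformHypergraph

open UniformHypergraph

/-! ### The upper bound on the Erdős–Rogers function -/

theorem theorem1p7 {r : ℕ} {V : Type*} [Finite V] (F : UniformHypergraph r V) :
    ∃ c : ℝ, 0 < c ∧
      ∀ k : ℕ, 2 ≤ k → k < r →
        ∀ (W : Type*) [Finite W] (G : UniformHypergraph r W), ¬ G.ShadowHom k F →
          ∀ᶠ n : ℕ in Filter.atTop,
            (F.erdosRogers G n : ℝ) ≤ c * Real.log (n : ℝ) ^ (1 / ((k : ℝ) - 1)) := by
  classical
  have := Fintype.ofFinite V
  set v := Fintype.card V with hv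
  -- The base `r + v + 1` makes `c` exceed `k` and `v`, so that a set of more than `c` vertices is
  -- large enough for the packing; the factors bound `k ^ k`, `(v.choose k) ^ 2` and
  -- `v ^ (k * v.choose k)` uniformly in `k < r`.
  refine ⟨((r + v + 1) ^ r * (2 ^ v) ^ 2 * (v + 1) ^ (r * 2 ^ v) : ℕ), by positivity, ?_⟩
  set c : ℕ := (r + v + 1) ^ r * (2 ^ v) ^ 2 * (v + 1) ^ (r * 2 ^ v) with hc
  intro k hk2 hkr W _ G hG
  filter_upwards [Filter.eventually_ge_atTop 3] with n hn
  have hL : 1 ≤ Real.log n := by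
    rw [Real.le_log_iff_exp_le (by positivity)]
    have : (3 : ℝ) ≤ n := by exact_mod_cast hn
    linarith [Real.exp_one_lt_d9]
  have hk1 : (0 : ℝ) < (k : ℝ) - 1 := by
    have : (2 : ℝ) ≤ k := by exact_mod_cast hk2
    linarith
  have hroot : 1 ≤ Real.log n ^ (1 / ((k : ℝ) - 1)) := Real.one_le_rpow hL (by positivity)
  have hc1 : r + v + 1 ≤ c := by
    have h1 : r + v + 1 ≤ (r + v + 1) ^ r := Nat.le_self_pow (by omega) _
    have h2 : 1 ≤ (2 ^ v) ^ 2 := Nat.one_le_iff_ne_zero.2 (by positivity)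
    have h3 : 1 ≤ (v + 1) ^ (r * 2 ^ v) := Nat.one_le_iff_ne_zero.2 (by positivity)
    calc r + v + 1 ≤ (r + v + 1) ^ r * 1 * 1 := by simpa using h1
      _ ≤ _ := Nat.mul_le_mul (Nat.mul_le_mul le_rfl h2) h3
  suffices h : ∀ m ∈ erdosRogersSet F G n, (m : ℝ) ≤ c * Real.log n ^ (1 / ((k : ℝ) - 1)) by
    rcases Set.eq_empty_or_nonempty (erdosRogersSet F G n) with he | hne
    · rw [erdosRogers, he]
      simp only [csSup_empty, bot_eq_zero', Nat.cast_zero]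
      positivity
    · have hb : BddAbove (erdosRogersSet F G n) :=
        ⟨⌊c * Real.log n ^ (1 / ((k : ℝ) - 1))⌋₊, fun m hm => Nat.le_floor (h m hm)⟩
      exact h _ (Nat.sSup_mem hne hb)
  intro m hm
  by_contra! hlt
  have hcm : c < m := by
    have : (c : ℝ) * 1 ≤ c * Real.log n ^ (1 / ((k : ℝ) - 1)) :=
      mul_le_mul_of_nonneg_left hroot (Nat.cast_nonneg _)
    have : (c : ℝ) < m := by linarith
    exact_mod_cast this
  -- If `F` has no edge, its vertex set may be too small for the packing, but every set of `v`
  -- vertices spans a copy of `F`.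
  rcases Set.eq_empty_or_nonempty F.edges with hF | ⟨e, he⟩
  · obtain ⟨e, he⟩ := edges_nonempty_of_not_shadowHom hG
    obtain ⟨U, hU, hfree⟩ := hm ⟨∅, fun e he => absurd he (by simp)⟩ fun ⟨φ, hφ⟩ => hφ e he
    obtain ⟨φ⟩ : Nonempty (V ↪ U) := Function.Embedding.nonempty_of_card_le (by
      rw [Fintype.card_coe, hU]
      omega)
    exact hfree ⟨φ, fun e he => absurd he (by simp [hF])⟩
  have hrv : r ≤ v := by
    rw [← F.card_eq e he]
    exact card_le_univ e
  have hV : Nonempty V := Fintype.card_pos_iff.1 (by omega)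
  obtain ⟨ω, hω⟩ := exists_colouring_contains_induce (k := k) (m := m) (α := Fin n) F
    (by omega) (by omega) (by
      rw [Fintype.card_fin, ← hv]
      refine lt_of_lt_of_le ?_ (div_pow_le_choose (by omega : k ≤ m))
      have hroot_lt : (c : ℝ) * Real.log n < (m : ℝ) ^ (k - 1) := by
        have hk1' : ((k - 1 : ℕ) : ℝ) = (k : ℝ) - 1 := by
          rw [Nat.cast_sub (by omega), Nat.cast_one]
        have hpow : (Real.log n ^ (1 / ((k : ℝ) - 1))) ^ (k - 1) = Real.log n := by
          rw [one_div, ← hk1']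
          exact Real.rpow_inv_natCast_pow (by linarith) (by omega)
        calc (c : ℝ) * Real.log n ≤ (c : ℝ) ^ (k - 1) * Real.log n := by
              refine mul_le_mul_of_nonneg_right ?_ (by linarith)
              exact le_self_pow₀ (by exact_mod_cast (by omega : 1 ≤ c)) (by omega)
          _ = (c * Real.log n ^ (1 / ((k : ℝ) - 1))) ^ (k - 1) := by rw [mul_pow, hpow]
          _ < (m : ℝ) ^ (k - 1) := pow_lt_pow_left₀ hlt (by positivity) (by omega)
      have hconst : (k : ℝ) ^ k * ((v.choose k : ℝ) ^ 2 * (v : ℝ) ^ (k * v.choose k)) ≤ c := by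
        have h1 : k ^ k ≤ (r + v + 1) ^ r :=
          (Nat.pow_le_pow_left (by omega) k).trans (Nat.pow_le_pow_right (by omega) hkr.le)
        have h2 : v.choose k ^ 2 ≤ (2 ^ v) ^ 2 := Nat.pow_le_pow_left (Nat.choose_le_two_pow _ _) 2
        have h3 : v ^ (k * v.choose k) ≤ (v + 1) ^ (r * 2 ^ v) :=
          (Nat.pow_le_pow_left (by omega) _).trans (Nat.pow_le_pow_right (by omega)
            (Nat.mul_le_mul hkr.le (Nat.choose_le_two_pow _ _)))
        rw [← mul_assoc]
        exact_mod_cast Nat.mul_le_mul (Nat.mul_le_mul h1 h2) h3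
      have hm0 : (0 : ℝ) < m := by exact_mod_cast (by omega : 0 < m)
      have hk0 : (0 : ℝ) < k := by exact_mod_cast (by omega : 0 < k)
      rw [div_pow, lt_div_iff₀ (by positivity)]
      calc (m : ℝ) * Real.log n * (v.choose k : ℝ) ^ 2 * (v : ℝ) ^ (k * v.choose k) * (k : ℝ) ^ k
          = m * Real.log n *
            ((k : ℝ) ^ k * ((v.choose k : ℝ) ^ 2 * (v : ℝ) ^ (k * v.choose k))) := by ring
        _ ≤ m * Real.log n * c := mul_le_mul_of_nonneg_left hconst (by positivity)
        _ = m * (c * Real.log n) := by ring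
        _ < m * (m : ℝ) ^ (k - 1) := mul_lt_mul_of_pos_left hroot_lt hm0
        _ = (m : ℝ) ^ k := by rw [← pow_succ', Nat.sub_add_cancel (by omega)])
  obtain ⟨U, hU, hfree⟩ := hm _ (freeOf_ofColouring hG ω)
  exact hfree (hω U hU)
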